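/- A planar doodle diagram is a connected $4$-valent graph $D$ (multiple edges and loops allowed, at least one vertex) embedded in the sphere; its vertices are called crossings and the components of its complement are called regions. A region is an $i$-gon if its boundary curve consists of $i$ edges. $D$ is minimal if it has no monogon and no bigon, and prime if its graph is $3$-connected (it has more than three vertices and the removal of at most two vertices never disconnects it). Let $D$ be a prime minimal planar doodle diagram with $n$ crossings, and let $f_i$ be the number of its $i$-gon regions. Choose a region of $D$, the infinite region, and let $p$ be its number of edges. Let $\Gamma$ be the dual graph of $D$, embedded in the sphere: it has one vertex for each region of $D$, and for each edge of $D$ one edge, joining the vertices of the two regions on its sides; the regions of $\Gamma$ are the components of its complement. Let $v_\infty$ be the vertex of $\Gamma$ that corresponds to the infinite region, let $\Delta$ be the union of all closed cells (vertices, edges and regions) of this cell decomposition of the sphere that do not contain $v_\infty$, and let $\Gamma' = \Gamma - v_\infty$ be the graph obtained by deleting $v_\infty$ and all edges at it. Then $\Delta$ is a disc, with a cell decomposition whose $1$-skeleton is $\Gamma'$ and whose boundary is an embedded circle in $\Gamma'$, and: 1. $\Gamma$ has $n+2$ vertices, $2n$ edges and $n$ regions. 2. $\Gamma'$ has $n+1$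 vertices. 3. The boundary of $\Delta$ contains $2p$ edges and $2p$ vertices. 4. $\Delta$ has $2n-3p$ interior edges and $n+1-2p$ interior vertices. 5. $\Delta$ has $n-p$ regions, all four-sided (bounded by an embedded circle of four edges and four vertices). 6. Among the vertices of $\Gamma'$, exactly $f_p-1$ have valency $p$ in $\Gamma$, and for each $i\ge 3$ with $i\ne p$ exactly $f_i$ have valency $i$ in $\Gamma$ (so edges to $v_\infty$ are counted in the valency). 7. Every region of $\Delta$ is adjacent, along an edge, to at least two other regions of $\Delta$. 8. Any two vertices of $\Gamma$ are joined by at most one edge of $\Gamma$. -/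

import Mathlib

/-- A cellular decomposition of a closed oriented surface, encoded as a combinatorial map
(a graph together with the cyclic order of the edge ends at every vertex).
An element of `δ` is a *dart*: an edge with a chosen direction, identified with the end
of the edge at the vertex from which it leaves.
`rot` sends a dart to the next one counterclockwise about its starting vertex and `flip` reverses
the direction. The surface is obtained by gluing a polygon to every closed boundary walk. -/
structure CellMap (δ : Type*) where
  rot : Equiv.Perm δ
  flip : Equiv.Perm δ
  flip_flip : ∀ d, flip (flip d) = d
  flip_ne : ∀ d, flip d ≠ d

namespace CellMap

variable {δ : Type*} (M : CellMap δ)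

/-- Walk along a dart and turn so as to keep on the boundary of the face on its left:
this traces the boundary of that face counterclockwise. -/
def turn : Equiv.Perm δ := M.rot⁻¹ * M.flip

/-- Vertices are the cycles of `rot`. -/
def Vertex : Type _ := Quotient (Equiv.Perm.SameCycle.setoid M.rot)

/-- (Undirected) edges are the pairs of opposite darts. -/
def Edge : Type _ := Quotient (Equiv.Perm.SameCycle.setoid M.flip)

/-- Faces are the closed boundary walks, i.e. the cycles of `turn`. -/
def Face : Type _ := Quotient (Equiv.Perm.SameCycle.setoid M.turn)

/-- The vertex from which a dart leaves. -/
def vertex (d : δ) : M.Vertex := Quotient.mk (Equiv.Perm.SameCycle.setoid M.rot) d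

/-- The edge underlying a dart. -/
def edge (d : δ) : M.Edge := Quotient.mk (Equiv.Perm.SameCycle.setoid M.flip) d

/-- The face on the left of a dart. -/
def face (d : δ) : M.Face := Quotient.mk (Equiv.Perm.SameCycle.setoid M.turn) d

/-- The valency of a vertex: the number of edge ends at it. -/
noncomputable def valency (v : M.Vertex) : ℕ := Nat.card {d // M.vertex d = v}

/-- The number of edges in the boundary walk of a face. -/
noncomputable def sides (f : M.Face) : ℕ := Nat.card {d // M.face d = f}

/-- The edge `e` joins the vertices `u` and `w`. -/
def Joins (e : M.Edge) (u w : M.Vertex) : Prop :=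
  ∃ d, M.edge d = e ∧ M.vertex d = u ∧ M.vertex (M.flip d) = w

/-- The vertex `v` is an end of the edge `e`. -/
def IsEnd (v : M.Vertex) (e : M.Edge) : Prop := ∃ d, M.edge d = e ∧ M.vertex d = v

/-- The vertex `v` lies in the boundary of the face `f`. -/
def IsCorner (v : M.Vertex) (f : M.Face) : Prop := ∃ d, M.face d = f ∧ M.vertex d = v

/-- The edge `e` lies in the boundary of the face `f`. -/
def IsSide (e : M.Edge) (f : M.Face) : Prop := ∃ d, M.edge d = e ∧ M.face d = f

/-- Two faces are adjacent if some edge has one of them on either side. -/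
def FaceAdj (f g : M.Face) : Prop := ∃ d, M.face d = f ∧ M.face (M.flip d) = g

/-- The face is four-sided: its boundary is an embedded circle made of four different edges
and four different vertices. -/
def IsFourSided (f : M.Face) : Prop :=
  M.sides f = 4 ∧ Set.InjOn M.edge {d | M.face d = f} ∧ Set.InjOn M.vertex {d | M.face d = f}

/-- The simple graph on the vertices, two different ones being adjacent
if they are joined by an edge. -/
def graph : SimpleGraph M.Vertex where
  Adj u w := u ≠ w ∧ ∃ e, M.Joins e u w
  symm := ⟨by
    rintro u w ⟨h, _, d, rfl, hu, hw⟩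
    exact ⟨h.symm, _, M.flip d, rfl, hw, by rw [M.flip_flip]; exact hu⟩⟩
  loopless := ⟨fun _ h => h.1 rfl⟩

/-- The Jordan curve property modulo 2: whenever a set `C` of edges has an even number of ends
at every vertex, the faces fall into two classes such that the edges of `C` are those with one
side in each class. In other words the first homology group modulo 2 of the surface vanishes. Among
the closed connected surfaces this singles out the sphere. -/
def IsPlanar : Prop :=
  ∀ C : Set M.Edge, (∀ v, Even (Nat.card {d // M.vertex d = v ∧ M.edge d ∈ C})) →
    ∃ S : Set M.Face, ∀ d, M.edge d ∈ C ↔ Xor (M.face d ∈ S) (M.face (M.flip d) ∈ S)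

/-- The dual cell decomposition on the same surface: its vertices are the faces of `M`. The dart
`d` now stands for the dual edge crossing `d` from its left to its right. -/
def dual : CellMap δ where
  rot := M.turn
  flip := M.flip
  flip_flip := M.flip_flip
  flip_ne := M.flip_ne

/-- The vertex of the dual decomposition that corresponds to a face. -/
def dualVertex (f : M.Face) : M.dual.Vertex := f

/-- A subcomplex: a set of cells that contains all cells in the boundary of each of its cells. -/
structure Subcomplex where
  verts : Set M.Vertex
  edges : Set M.Edge
  faces : Set M.Face
  ends_mem : ∀ e ∈ edges, ∀ v, M.IsEnd v e → v ∈ verts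
  sides_mem : ∀ f ∈ faces, ∀ e, M.IsSide e f → e ∈ edges

theorem vertex_turn (d : δ) : M.vertex (M.turn d) = M.vertex (M.flip d) := by
  refine Quotient.sound (s := Equiv.Perm.SameCycle.setoid M.rot) ?_
  exact ⟨1, by simp [turn]⟩

theorem face_turn (d : δ) : M.face (M.turn d) = M.face d := by
  refine Quotient.sound (s := Equiv.Perm.SameCycle.setoid M.turn) ?_
  exact ⟨-1, by simp⟩

theorem eq_or_eq_flip {d d' : δ} (h : M.edge d = M.edge d') : d' = d ∨ d' = M.flip d := by
  obtain ⟨i, hi⟩ : Equiv.Perm.SameCycle M.flip d d' := Quotient.exact h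
  have h2 : M.flip ^ (2 : ℤ) = 1 := by
    ext x
    simp [zpow_ofNat, pow_two, M.flip_flip]
  rcases Int.even_or_odd' i with ⟨k, rfl | rfl⟩
  · left
    simpa [zpow_mul, h2] using hi.symm
  · right
    simpa [zpow_add, zpow_mul, h2] using hi.symm

/-- The complement of the open star of a vertex `v`: all closed cells that avoid `v`. -/
def awayFrom (v : M.Vertex) : M.Subcomplex where
  verts := {w | w ≠ v}
  edges := {e | ¬ M.IsEnd v e}
  faces := {f | ¬ M.IsCorner v f}
  ends_mem := by
    rintro e he w hw rfl
    exact he hw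
  sides_mem := by
    rintro _ hf _ ⟨d, rfl, rfl⟩ ⟨d', hd', rfl⟩
    rcases M.eq_or_eq_flip hd'.symm with rfl | rfl
    · exact hf ⟨_, rfl, rfl⟩
    · exact hf ⟨M.turn d, M.face_turn d, M.vertex_turn d⟩

namespace Subcomplex

variable {M} (K : M.Subcomplex)

/-- The 1-skeleton of a subcomplex (as a simple graph). -/
def skeleton : SimpleGraph K.verts where
  Adj u w := u ≠ w ∧ ∃ e ∈ K.edges, M.Joins e u w
  symm := ⟨by
    rintro u w ⟨h, _, he, d, rfl, hu, hw⟩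
    refine ⟨h.symm, _, he, M.flip d, ?_, hw, by rw [M.flip_flip]; exact hu⟩
    exact Quotient.sound (s := Equiv.Perm.SameCycle.setoid M.flip) ⟨-1, by simp⟩⟩
  loopless := ⟨fun _ h => h.1 rfl⟩

/-- The vertices on the topological boundary: those in contact with a face outside. -/
def boundaryVerts : Set M.Vertex := {v ∈ K.verts | ∃ f ∉ K.faces, M.IsCorner v f}

/-- The edges on the topological boundary: those in contact with a face outside. -/
def boundaryEdges : Set M.Edge := {e ∈ K.edges | ∃ f ∉ K.faces, M.IsSide e f}

def interiorVerts : Set M.Vertex := K.verts \ K.boundaryVerts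

def interiorEdges : Set M.Edge := K.edges \ K.boundaryEdges

/-- The boundary is a single embedded circle: its vertices and its edges can be numbered
cyclically, without repetition, so that each edge joins its vertex to the next one. -/
def BoundaryIsCircle : Prop :=
  ∃ m : ℕ, 0 < m ∧ ∃ (b : ZMod m → M.Vertex) (c : ZMod m → M.Edge),
    Function.Injective b ∧ Function.Injective c ∧
    Set.range b = K.boundaryVerts ∧ Set.range c = K.boundaryEdges ∧
    ∀ i, M.Joins (c i) (b i) (b (i + 1))

/-- The subcomplex is a disc: a connected piece of the surface, bounded by one embedded circle,
with Euler characteristic 1. -/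
def IsDisc : Prop :=
  K.skeleton.Connected ∧ K.BoundaryIsCircle ∧
    (K.verts.ncard : ℤ) - K.edges.ncard + K.faces.ncard = 1

end Subcomplex

end CellMap

/-- A graph is `k`-connected if it has more than `k` vertices and is not disconnected
by the removal of fewer than `k` vertices. -/
def SimpleGraph.IsKConnected {V : Type*} (G : SimpleGraph V) (k : ℕ) : Prop :=
  k < Nat.card V ∧ ∀ S : Set V, S.ncard < k → (G.induce Sᶜ).Connected

/-- A planar (irreducible, non-trivial) doodle diagram: a connected 4-valent graph in the sphere.
The components are recovered by going straight across at every crossing. Orientations of the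
components play no role. -/
structure DoodleDiagram (δ : Type*) extends CellMap δ where
  four_valent : ∀ v, toCellMap.valency v = 4
  connected : toCellMap.graph.Connected
  planar : toCellMap.IsPlanar

namespace DoodleDiagram

variable {δ : Type*} (D : DoodleDiagram δ)

abbrev Crossing : Type _ := D.toCellMap.Vertex

abbrev Region : Type _ := D.toCellMap.Face

/-- The diagram (which is connected) has no monogon and no bigon. -/
def IsMinimal : Prop := ∀ R : D.Region, 3 ≤ D.toCellMap.sides R

/-- The underlying graph is 3-connected. -/
def IsPrime : Prop := D.toCellMap.graph.IsKConnected 3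

/-- The dual graph, with its embedding in the sphere. -/
abbrev dualGraph : CellMap δ := D.toCellMap.dual

/-- The vertex of the dual graph that corresponds to a region. -/
abbrev regionVertex (R : D.Region) : D.dualGraph.Vertex := D.toCellMap.dualVertex R

/-- The number of `i`-gon regions. -/
noncomputable def numGons (i : ℕ) : ℕ := Nat.card {R : D.Region // D.toCellMap.sides R = i}

end DoodleDiagram

/-!
A planar cell decomposition has no homology modulo 2 in degree one: the kernel of the vertex-edge
incidence matrix is the row space of the face-edge one. Comparing ranks gives the Euler formula, and
every dual cycle modulo 2 is the coboundary of a labelling of the crossings.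

Suppose that two regions of a prime diagram have two crossings in common. A closed curve through
both regions and both crossings meets the graph nowhere else, so by 3-connectivity one of its sides
contains no crossing, and every edge that leaves the first crossing on that side ends at the second.
Parallel edges would bound a bigon, hence there is only one such edge, and both regions lie along
it. Consequently `Γ` is simple, and the regions met while walking around the infinite region,
entering two new ones at each of its corners, are all different.
-/

open Matrix

theorem eq_of_preconnected_of_adj {V α : Type*} {G : SimpleGraph V} (hG : G.Preconnected)
    (s : V → α) (hs : ∀ u w, G.Adj u w → s u = s w) (u w : V) : s u = s w := by
  obtain ⟨p⟩ := hG u w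
  induction p with
  | nil => rfl
  | cons h _ ih => exact (hs _ _ h).trans ih

theorem exists_adj_notMem_of_isKConnected {V : Type*} [Finite V] {G : SimpleGraph V} {k : ℕ}
    (hG : G.IsKConnected k) {S : Set V} (hS : S.ncard < k) (v : V) : ∃ w ∉ S, G.Adj v w := by
  have hlt : (S \ {v}).ncard < k := (Set.ncard_le_ncard Set.sdiff_subset).trans_lt hS
  have hcard : 1 < ((S \ {v})ᶜ : Set V).ncard := by
    have h1 := Set.ncard_add_ncard_compl (S \ {v})
    have h2 := hG.1
    omega
  have : Nontrivial ((S \ {v})ᶜ : Set V) := Set.one_lt_ncard_iff_nontrivial.1 hcard |>.coe_sort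
  obtain ⟨⟨w, hw⟩, hvw⟩ := (hG.2 _ hlt).preconnected.exists_adj_of_nontrivial ⟨v, by simp⟩
  exact ⟨w, fun hwS => hw ⟨hwS, fun h => hvw.ne (Subtype.ext h.symm)⟩, hvw⟩

section LinearAlgebra

variable {K V E F : Type*} [Field K] [Fintype E] [Fintype F]
  {A : Matrix V E K} {B : Matrix F E K}

theorem rank_add_rank_of_ker_eq_range_transpose
    (h : LinearMap.ker A.mulVecLin = LinearMap.range Bᵀ.mulVecLin) :
    A.rank + B.rank = Fintype.card E := by
  have hA := A.mulVecLin.finrank_range_add_finrank_ker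
  rw [h, Module.finrank_fintype_fun_eq_card] at hA
  rwa [← B.rank_transpose]

theorem ker_eq_range_transpose_symm [Fintype V]
    (h : LinearMap.ker A.mulVecLin = LinearMap.range Bᵀ.mulVecLin) :
    LinearMap.ker B.mulVecLin = LinearMap.range Aᵀ.mulVecLin := by
  have hAB : A * Bᵀ = 0 := by
    apply mulVec_injective
    funext s
    have hs : Bᵀ *ᵥ s ∈ LinearMap.ker A.mulVecLin := h ▸ ⟨s, rfl⟩
    rw [← mulVec_mulVec, zero_mulVec]
    exact hs
  have hBA : B * Aᵀ = 0 := by simpa using congrArg transpose hAB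
  have hle : LinearMap.range Aᵀ.mulVecLin ≤ LinearMap.ker B.mulVecLin := by
    rintro _ ⟨s, rfl⟩
    rw [LinearMap.mem_ker, mulVecLin_apply, mulVecLin_apply, mulVec_mulVec, hBA, zero_mulVec]
  refine (Submodule.eq_of_le_of_finrank_eq hle ?_).symm
  have hB := B.mulVecLin.finrank_range_add_finrank_ker
  have hrank := rank_add_rank_of_ker_eq_range_transpose h
  rw [Module.finrank_fintype_fun_eq_card] at hB
  change Aᵀ.rank = _
  change B.rank + _ = _ at hB
  rw [rank_transpose]
  omega

end LinearAlgebra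

namespace CellMap

variable {δ : Type*} (M : CellMap δ)

instance [Finite δ] : Finite M.Vertex := inferInstanceAs (Finite (Quotient _))
instance [Finite δ] : Finite M.Edge := inferInstanceAs (Finite (Quotient _))
instance [Finite δ] : Finite M.Face := inferInstanceAs (Finite (Quotient _))

theorem vertex_surjective : Function.Surjective M.vertex := Quotient.mk_surjective
theorem edge_surjective : Function.Surjective M.edge := Quotient.mk_surjective
theorem face_surjective : Function.Surjective M.face := Quotient.mk_surjective

theorem vertex_eq_iff {d d' : δ} : M.vertex d = M.vertex d' ↔ M.rot.SameCycle d d' :=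
  Quotient.eq (r := Equiv.Perm.SameCycle.setoid M.rot)

theorem edge_flip (d : δ) : M.edge (M.flip d) = M.edge d :=
  Quotient.sound (s := Equiv.Perm.SameCycle.setoid M.flip) ⟨-1, by simp⟩

theorem edge_eq_iff {d d' : δ} : M.edge d = M.edge d' ↔ d' = d ∨ d' = M.flip d := by
  refine ⟨M.eq_or_eq_flip, ?_⟩
  rintro (rfl | rfl)
  exacts [rfl, (M.edge_flip d).symm]

theorem vertex_rot (d : δ) : M.vertex (M.rot d) = M.vertex d :=
  M.vertex_eq_iff.2 ⟨-1, by simp⟩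

theorem vertex_rot_iterate (k : ℕ) (d : δ) : M.vertex (M.rot^[k] d) = M.vertex d := by
  rw [Equiv.Perm.iterate_eq_pow]
  exact M.vertex_eq_iff.2 ⟨-(k : ℤ), by simp⟩

theorem rot_turn (d : δ) : M.rot (M.turn d) = M.flip d := by
  simp [turn]

theorem turn_flip_rot (d : δ) : M.turn (M.flip (M.rot d)) = d := by
  simp [turn, M.flip_flip]

theorem face_flip_rot (d : δ) : M.face (M.flip (M.rot d)) = M.face d := by
  rw [← M.face_turn, M.turn_flip_rot]

theorem face_flip_rot_iterate (k : ℕ) (d : δ) :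
    M.face (M.flip (M.rot^[k + 1] d)) = M.face (M.rot^[k] d) := by
  rw [Function.iterate_succ_apply', M.face_flip_rot]

theorem face_turn_iterate (k : ℕ) (d : δ) : M.face (M.turn^[k] d) = M.face d :=
  M.dual.vertex_rot_iterate k d

theorem isCorner_face (d : δ) : M.IsCorner (M.vertex d) (M.face d) := ⟨d, rfl, rfl⟩

theorem isCorner_flip_face (d : δ) : M.IsCorner (M.vertex (M.flip d)) (M.face d) :=
  ⟨M.turn d, M.face_turn d, M.vertex_turn d⟩

section Cycles

variable [Finite δ]

theorem exists_rot_iterate_eq {d y : δ} (h : M.vertex d = M.vertex y) :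
    ∃ i < Function.minimalPeriod M.rot d, M.rot^[i] d = y := by
  obtain ⟨i, -, rfl⟩ := (M.vertex_eq_iff.1 h).exists_pow_eq'
  refine ⟨i % Function.minimalPeriod M.rot d, Nat.mod_lt _ ?_, ?_⟩
  · exact Function.minimalPeriod_pos_of_mem_periodicPts (M.rot.injective.mem_periodicPts d)
  · rw [Function.iterate_mod_minimalPeriod_eq, Equiv.Perm.iterate_eq_pow]

theorem valency_vertex (d : δ) :
    M.valency (M.vertex d) = Function.minimalPeriod M.rot d := by
  let e (i : Fin (Function.minimalPeriod M.rot d)) : {y // M.vertex y = M.vertex d} :=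
    ⟨M.rot^[i] d, M.vertex_rot_iterate i d⟩
  have he : Function.Bijective e := by
    refine ⟨fun i j h => Fin.ext ?_, fun ⟨y, hy⟩ => ?_⟩
    · exact Function.iterate_injOn_Iio_minimalPeriod i.2 j.2 (congrArg Subtype.val h)
    · obtain ⟨i, hi, rfl⟩ := M.exists_rot_iterate_eq hy.symm
      exact ⟨⟨i, hi⟩, rfl⟩
  rw [valency, ← Nat.card_eq_of_bijective e he, Nat.card_fin]

variable {M} in
theorem vertex_induction {d : δ} {P : δ → Prop} (base : P d)
    (rot : ∀ y, M.vertex y = M.vertex d → P y → P (M.rot y)) {y : δ}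
    (hy : M.vertex d = M.vertex y) : P y := by
  obtain ⟨i, -, rfl⟩ := M.exists_rot_iterate_eq hy
  clear hy
  induction i with
  | zero => exact base
  | succ i ih =>
    rw [Function.iterate_succ_apply']
    exact rot _ (M.vertex_rot_iterate i d) ih

end Cycles

variable {α : Type*} {M}

theorem eq_of_preconnected_induce {S : Set M.Vertex} (hS : (M.graph.induce S).Preconnected)
    (s : M.Vertex → α) (hs : ∀ d, M.vertex d ∈ S → M.vertex (M.flip d) ∈ S →
      s (M.vertex d) = s (M.vertex (M.flip d)))
    {u w : M.Vertex} (hu : u ∈ S) (hw : w ∈ S) : s u = s w := by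
  refine eq_of_preconnected_of_adj hS (fun x => s x) ?_ ⟨u, hu⟩ ⟨w, hw⟩
  rintro ⟨_, hx⟩ ⟨_, hy⟩ ⟨-, _, d, -, rfl, rfl⟩
  exact hs d hx hy

theorem face_eq_of_preconnected_induce [Finite δ] {S : Set M.Vertex}
    (hS : (M.graph.induce S).Preconnected) (s : M.Face → α)
    (hs : ∀ d, M.vertex d ∈ S → s (M.face d) = s (M.face (M.flip d)))
    {d d' : δ} (hd : M.vertex d ∈ S) (hd' : M.vertex d' ∈ S) : s (M.face d) = s (M.face d') := by
  have around {x y : δ} (hx : M.vertex x ∈ S) (hxy : M.vertex x = M.vertex y) :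
      s (M.face y) = s (M.face x) := by
    refine vertex_induction (P := fun z => s (M.face z) = s (M.face x)) rfl (fun z hz h => ?_) hxy
    rw [hs (M.rot z) (by rwa [M.vertex_rot, hz]), M.face_flip_rot, h]
  let dart : M.Vertex → δ := Function.surjInv M.vertex_surjective
  have ht {y : δ} (hy : M.vertex y ∈ S) : s (M.face (dart (M.vertex y))) = s (M.face y) :=
    (around hy (Function.surjInv_eq M.vertex_surjective _).symm)
  rw [← ht hd, ← ht hd']
  exact eq_of_preconnected_induce hS (fun v => s (M.face (dart v)))
    (fun y hy hy' => by rw [ht hy, ht hy', hs y hy]) hd hd'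

theorem face_eq_of_connected [Finite δ] (hM : M.graph.Connected) (s : M.Face → α)
    (hs : ∀ d, s (M.face d) = s (M.face (M.flip d))) (f g : M.Face) : s f = s g := by
  obtain ⟨d, rfl⟩ := M.face_surjective f
  obtain ⟨d', rfl⟩ := M.face_surjective g
  exact face_eq_of_preconnected_induce
    ((SimpleGraph.induceUnivIso _).preconnected_iff.2 hM.preconnected) s (fun d _ => hs d)
    (Set.mem_univ _) (Set.mem_univ _)

theorem vertex_eq_of_connected (hM : M.graph.Connected) (s : M.Vertex → α)
    (hs : ∀ d, s (M.vertex d) = s (M.vertex (M.flip d))) (u w : M.Vertex) : s u = s w :=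
  eq_of_preconnected_induce ((SimpleGraph.induceUnivIso _).preconnected_iff.2 hM.preconnected) s
    (fun d _ _ => hs d) (Set.mem_univ _) (Set.mem_univ _)

/-! ### Incidence modulo 2 and the Euler formula -/

variable (M) {X : Type*} (φ : δ → X)

noncomputable instance [Finite δ] : Fintype M.Vertex := Fintype.ofFinite _
noncomputable instance [Finite δ] : Fintype M.Edge := Fintype.ofFinite _
noncomputable instance [Finite δ] : Fintype M.Face := Fintype.ofFinite _

open Classical in
/-- The incidence matrix modulo 2 of edges and the classes of a labelling of the darts. For
`M.vertex` this is the incidence matrix of vertices and edges, for `M.face` that of faces and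
edges; an edge with the same label on both darts has an even entry, i.e. zero. -/
noncomputable def incidence : Matrix X M.Edge (ZMod 2) := fun x =>
  Quotient.lift (fun d => (if φ d = x then 1 else 0) + if φ (M.flip d) = x then 1 else 0) (by
    intro a b h
    rcases M.eq_or_eq_flip (d := a) (d' := b) (Quotient.sound h) with rfl | rfl
    · rfl
    · rw [M.flip_flip, add_comm])

open Classical in
theorem incidence_edge (x : X) (d : δ) : M.incidence φ x (M.edge d) =
    (if φ d = x then 1 else 0) + if φ (M.flip d) = x then 1 else 0 := rfl

theorem transpose_incidence_mulVec [Fintype X] (s : X → ZMod 2) (d : δ) :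
    ((M.incidence φ)ᵀ *ᵥ s) (M.edge d) = s (φ d) + s (φ (M.flip d)) := by
  classical
  simp [mulVec, dotProduct, incidence_edge, add_mul, Finset.sum_add_distrib]

variable {M φ}

theorem rank_incidence_add_one [Finite δ] [Fintype X] [Nonempty X]
    (h : ∀ s : X → ZMod 2, (∀ d, s (φ d) = s (φ (M.flip d))) → ∀ x y, s x = s y) :
    (M.incidence φ).rank + 1 = Fintype.card X := by
  have hker : LinearMap.ker (M.incidence φ)ᵀ.mulVecLin = Submodule.span (ZMod 2) {1} := by
    ext s
    rw [Submodule.mem_span_singleton, LinearMap.mem_ker, mulVecLin_apply]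
    constructor
    · intro hs
      refine ⟨s (Classical.arbitrary X), funext fun x => ?_⟩
      have hd (d : δ) : s (φ d) = s (φ (M.flip d)) := by
        rw [← CharTwo.add_eq_zero, ← M.transpose_incidence_mulVec, hs, Pi.zero_apply]
      simpa using h s hd _ x
    · rintro ⟨a, rfl⟩
      ext e
      obtain ⟨d, rfl⟩ := M.edge_surjective e
      simp [transpose_incidence_mulVec, CharTwo.add_self_eq_zero]
  have hdim := (M.incidence φ)ᵀ.mulVecLin.finrank_range_add_finrank_ker
  rwa [hker, finrank_span_singleton one_ne_zero, Module.finrank_fintype_fun_eq_card,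
    ← Matrix.rank, rank_transpose] at hdim

variable (M φ)

theorem sum_edge_eq_sum_dart [Fintype δ] {g : δ → ZMod 2} {h : M.Edge → ZMod 2}
    (hg : ∀ d, h (M.edge d) = g d + g (M.flip d)) : ∑ e, h e = ∑ d, g d := by
  classical
  rw [← Finset.sum_fiberwise (s := Finset.univ) (g := M.edge) (f := g)]
  refine Finset.sum_congr rfl fun e _ => ?_
  obtain ⟨d, rfl⟩ := M.edge_surjective e
  have hfiber : (Finset.univ.filter fun x => M.edge x = M.edge d) = {d, M.flip d} := by
    ext x
    simp [eq_comm (b := M.edge d), M.edge_eq_iff]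
  rw [hfiber, Finset.sum_pair (M.flip_ne d).symm, hg]

open Classical in
theorem incidence_mulVec_apply [Fintype δ] (c : M.Edge → ZMod 2) (x : X) :
    (M.incidence φ *ᵥ c) x = ∑ d, if φ d = x then c (M.edge d) else 0 :=
  M.sum_edge_eq_sum_dart fun d => by simp [incidence_edge, M.edge_flip, add_mul]

open Classical in
theorem incidence_mulVec_single [Finite δ] (d : δ) :
    M.incidence φ *ᵥ Pi.single (M.edge d) 1 =
      Pi.single (φ d) 1 + Pi.single (φ (M.flip d)) 1 := by
  ext x
  simp [incidence_edge, Pi.single_apply, eq_comm]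

theorem incidence_vertex_mul_transpose_incidence_face [Finite δ] :
    M.incidence M.vertex * (M.incidence M.face)ᵀ = 0 := by
  classical
  have := Fintype.ofFinite δ
  ext v f
  change (M.incidence M.vertex *ᵥ M.incidence M.face f) v = 0
  have hturn : (∑ d, if M.vertex d = v ∧ M.face (M.flip d) = f then (1 : ZMod 2) else 0) =
      ∑ d, if M.vertex d = v ∧ M.face d = f then 1 else 0 := by
    rw [← Equiv.sum_comp M.rot]
    simp only [M.vertex_rot, M.face_flip_rot]
  have hsplit (d : δ) : (if M.vertex d = v then M.incidence M.face f (M.edge d) else 0) =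
      (if M.vertex d = v ∧ M.face d = f then 1 else 0) +
        if M.vertex d = v ∧ M.face (M.flip d) = f then 1 else 0 := by
    by_cases h : M.vertex d = v <;> simp [h, incidence_edge]
  simp only [incidence_mulVec_apply, hsplit, Finset.sum_add_distrib, hturn,
    CharTwo.add_self_eq_zero]

variable {M}

namespace IsPlanar

variable [Finite δ]

theorem exists_face_labelling (hM : M.IsPlanar) {c : M.Edge → ZMod 2}
    (hc : M.incidence M.vertex *ᵥ c = 0) :
    ∃ s : M.Face → ZMod 2, ∀ d, c (M.edge d) = s (M.face d) + s (M.face (M.flip d)) := by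
  classical
  have := Fintype.ofFinite δ
  have zero_or_one (x : ZMod 2) : x = 0 ∨ x = 1 := by revert x; decide
  have heven (v : M.Vertex) : Even (Nat.card {d // M.vertex d = v ∧ M.edge d ∈ {e | c e = 1}}) := by
    rw [← ZMod.natCast_eq_zero_iff_even, Nat.card_eq_fintype_card, Fintype.card_subtype,
      Finset.natCast_card_filter]
    refine Eq.trans ?_ (congrFun hc v)
    rw [incidence_mulVec_apply]
    refine Finset.sum_congr rfl fun d _ => ?_
    rcases zero_or_one (c (M.edge d)) with h | h <;> simp [h]
  obtain ⟨S, hS⟩ := hM _ heven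
  refine ⟨S.indicator 1, fun d => ?_⟩
  have hd : c (M.edge d) = 1 ↔ Xor (M.face d ∈ S) (M.face (M.flip d) ∈ S) := hS d
  have one_add_one : (1 : ZMod 2) + 1 = 0 := rfl
  rcases zero_or_one (c (M.edge d)) with h | h <;> by_cases h4 : M.face d ∈ S <;>
    by_cases h5 : M.face (M.flip d) ∈ S <;> simp_all [Xor]

theorem exists_face_labelling_of_parallel (hM : M.IsPlanar) {x y : δ} (hne : M.edge x ≠ M.edge y)
    (hv : M.vertex x = M.vertex y) (hw : M.vertex (M.flip x) = M.vertex (M.flip y)) :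
    ∃ s : M.Face → ZMod 2, ∀ d, s (M.face d) = s (M.face (M.flip d)) ↔
      M.edge d ≠ M.edge x ∧ M.edge d ≠ M.edge y := by
  classical
  obtain ⟨s, hs⟩ := hM.exists_face_labelling
    (c := Pi.single (M.edge x) 1 + Pi.single (M.edge y) 1) (by
      rw [mulVec_add, incidence_mulVec_single, incidence_mulVec_single, hv, hw]
      exact ZModModule.add_self _)
  refine ⟨s, fun d => ?_⟩
  rw [← CharTwo.add_eq_zero, ← hs, Pi.add_apply, Pi.single_apply, Pi.single_apply]
  by_cases hx : M.edge d = M.edge x <;> by_cases hy : M.edge d = M.edge y <;> simp_all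

theorem ker_incidence_vertex (hM : M.IsPlanar) :
    LinearMap.ker (M.incidence M.vertex).mulVecLin =
      LinearMap.range (M.incidence M.face)ᵀ.mulVecLin := by
  ext c
  constructor
  · intro hc
    obtain ⟨s, hs⟩ := hM.exists_face_labelling hc
    refine ⟨s, funext fun e => ?_⟩
    obtain ⟨d, rfl⟩ := M.edge_surjective e
    rw [hs, mulVecLin_apply, transpose_incidence_mulVec]
  · rintro ⟨s, rfl⟩
    rw [LinearMap.mem_ker, mulVecLin_apply, mulVecLin_apply, mulVec_mulVec,
      incidence_vertex_mul_transpose_incidence_face, zero_mulVec]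

theorem exists_vertex_labelling (hM : M.IsPlanar) {c : M.Edge → ZMod 2}
    (hc : M.incidence M.face *ᵥ c = 0) :
    ∃ s : M.Vertex → ZMod 2, ∀ d, c (M.edge d) = s (M.vertex d) + s (M.vertex (M.flip d)) := by
  have hrange : c ∈ LinearMap.range (M.incidence M.vertex)ᵀ.mulVecLin :=
    ker_eq_range_transpose_symm hM.ker_incidence_vertex ▸ hc
  obtain ⟨s, rfl⟩ := hrange
  exact ⟨s, M.transpose_incidence_mulVec _ s⟩

theorem card_vertex_add_card_face (hM : M.IsPlanar) (hconn : M.graph.Connected) :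
    Nat.card M.Vertex + Nat.card M.Face = Nat.card M.Edge + 2 := by
  have := hconn.nonempty
  have : Nonempty M.Face := (Function.Surjective.nonempty M.vertex_surjective).map M.face
  simp only [Nat.card_eq_fintype_card]
  have hV := rank_incidence_add_one (vertex_eq_of_connected (α := ZMod 2) hconn)
  have hF := rank_incidence_add_one (face_eq_of_connected (α := ZMod 2) hconn)
  have hE := rank_add_rank_of_ker_eq_range_transpose hM.ker_incidence_vertex
  omega

end IsPlanar

variable (M) in
open Classical in
/-- The sum modulo 2 of the `k` edges that follow the dart `d` in the cyclic order
about its starting vertex. In the dual it is a path from the face of `d` to that of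
`M.rot^[k] d`. -/
noncomputable def arcChain (d : δ) (k : ℕ) : M.Edge → ZMod 2 :=
  ∑ i ∈ Finset.range k, Pi.single (M.edge (M.rot^[i + 1] d)) 1

open Classical in
theorem incidence_face_mulVec_arcChain [Finite δ] (d : δ) (k : ℕ) :
    M.incidence M.face *ᵥ M.arcChain d k =
      Pi.single (M.face d) 1 + Pi.single (M.face (M.rot^[k] d)) 1 := by
  induction k with
  | zero => ext; simp [arcChain, CharTwo.add_self_eq_zero]
  | succ k ih =>
    have hsucc : M.arcChain d (k + 1) =
        M.arcChain d k + Pi.single (M.edge (M.rot^[k + 1] d)) 1 := Finset.sum_range_succ _ _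
    have hflip : M.face (M.flip (M.rot^[k + 1] d)) = M.face (M.rot^[k] d) := by
      rw [Function.iterate_succ_apply', face_flip_rot]
    rw [hsucc, mulVec_add, ih, incidence_mulVec_single, hflip]
    linear_combination ZModModule.add_self
      (Pi.single (M.face (M.rot^[k] d)) 1 : M.Face → ZMod 2)

open Classical in
theorem arcChain_apply (d : δ) (k : ℕ) (e : M.Edge) : M.arcChain d k e =
    ∑ i ∈ Finset.range k, if M.edge (M.rot^[i + 1] d) = e then 1 else 0 := by
  simp only [arcChain, Finset.sum_apply, Pi.single_apply, eq_comm (a := e)]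

theorem arcChain_eq_zero {d y : δ} (k : ℕ) (h : M.vertex y ≠ M.vertex d)
    (h' : M.vertex (M.flip y) ≠ M.vertex d) : M.arcChain d k (M.edge y) = 0 := by
  rw [arcChain_apply]
  refine Finset.sum_eq_zero fun i _ => if_neg fun hi => ?_
  rcases M.edge_eq_iff.1 hi with rfl | rfl
  · exact h (M.vertex_rot_iterate _ d)
  · rw [M.flip_flip] at h'
    exact h' (M.vertex_rot_iterate _ d)

/-! ### The dual decomposition -/

variable (M)

/-- The vertices of a cell decomposition are the faces of its dual: the dual face around a vertex
has on its left the darts that arrive at that vertex. -/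
def dualFace : M.Vertex ≃ M.dual.Face :=
  Quotient.congr M.flip fun d d' => by
    have hturn : M.dual.turn = M.flip⁻¹ * M.rot * M.flip⁻¹⁻¹ := by simp [turn, dual, mul_assoc]
    change M.rot.SameCycle d d' ↔ M.dual.turn.SameCycle (M.flip d) (M.flip d')
    rw [hturn, Equiv.Perm.sameCycle_conj]
    simp [M.flip_flip]

theorem dualFace_vertex (d : δ) : M.dualFace (M.vertex d) = M.dual.face (M.flip d) := rfl

variable {M}

theorem dual_face_eq_dualFace_iff {d : δ} {v : M.Vertex} :
    M.dual.face d = M.dualFace v ↔ M.vertex (M.flip d) = v := by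
  rw [← M.dualFace.injective.eq_iff, dualFace_vertex, M.flip_flip]

theorem sides_dualFace (v : M.Vertex) : M.dual.sides (M.dualFace v) = M.valency v :=
  Nat.card_congr (M.flip.subtypeEquiv fun _ => dual_face_eq_dualFace_iff)

theorem isCorner_dualFace {f : M.Face} {v : M.Vertex} :
    M.dual.IsCorner (M.dualVertex f) (M.dualFace v) ↔ M.IsCorner v f := by
  constructor
  · rintro ⟨d, hd, rfl⟩
    rw [← dual_face_eq_dualFace_iff.1 hd]
    exact M.isCorner_flip_face d
  · rintro ⟨d, rfl, rfl⟩
    refine ⟨M.flip (M.rot d), ?_, M.face_flip_rot d⟩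
    rw [dual_face_eq_dualFace_iff, M.flip_flip, M.vertex_rot]

theorem mem_edges_awayFrom {v : M.Vertex} {d : δ} :
    M.edge d ∈ (M.awayFrom v).edges ↔ M.vertex d ≠ v ∧ M.vertex (M.flip d) ≠ v := by
  refine Iff.trans (not_congr ⟨?_, ?_⟩) not_or
  · rintro ⟨d', hd', rfl⟩
    rcases M.eq_or_eq_flip hd' with rfl | rfl
    exacts [.inl rfl, .inr (congrArg M.vertex (M.flip_flip d'))]
  · rintro (h | h)
    exacts [⟨d, rfl, h⟩, ⟨M.flip d, M.edge_flip d, h⟩]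

section Counting

variable [Finite δ]

theorem card_dart_eq_two_mul_card_edge : Nat.card δ = 2 * Nat.card M.Edge := by
  have hfib (e : M.Edge) : Nat.card {d // M.edge d = e} = 2 := by
    obtain ⟨d, rfl⟩ := M.edge_surjective e
    have h : {d' | M.edge d' = M.edge d} = {d, M.flip d} := by
      ext d'
      exact eq_comm.trans M.edge_eq_iff
    exact (congrArg Set.ncard h).trans (Set.ncard_pair (M.flip_ne d).symm)
  rw [Nat.card_congr (Equiv.sigmaFiberEquiv M.edge).symm, Nat.card_sigma]
  simp [hfib, mul_comm]

theorem card_dart_eq_mul_card_vertex {k : ℕ} (hk : ∀ v, M.valency v = k) :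
    Nat.card δ = k * Nat.card M.Vertex := by
  rw [Nat.card_congr (Equiv.sigmaFiberEquiv M.vertex).symm, Nat.card_sigma]
  simp [show ∀ v, Nat.card {d // M.vertex d = v} = k from hk, mul_comm]

theorem ncard_verts_awayFrom_add_one (v : M.Vertex) :
    (M.awayFrom v).verts.ncard + 1 = Nat.card M.Vertex := by
  rw [← Set.ncard_add_ncard_compl {v}, Set.ncard_singleton, add_comm]
  rfl

theorem ncard_edges_awayFrom_add_valency {v : M.Vertex}
    (hv : Set.InjOn M.edge {d | M.vertex d = v}) :
    (M.awayFrom v).edges.ncard + M.valency v = Nat.card M.Edge := by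
  have h : (M.awayFrom v).edges = (M.edge '' {d | M.vertex d = v})ᶜ := by
    ext e
    exact not_congr (exists_congr fun d => and_comm)
  rw [h, ← Set.ncard_add_ncard_compl (M.edge '' {d | M.vertex d = v}), hv.ncard_image, add_comm]
  rfl

theorem ncard_faces_awayFrom_add_valency {v : M.Vertex}
    (hv : Set.InjOn M.face {d | M.vertex d = v}) :
    (M.awayFrom v).faces.ncard + M.valency v = Nat.card M.Face := by
  have h : (M.awayFrom v).faces = (M.face '' {d | M.vertex d = v})ᶜ := by
    ext f
    exact not_congr (exists_congr fun d => and_comm)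
  rw [h, ← Set.ncard_add_ncard_compl (M.face '' {d | M.vertex d = v}), hv.ncard_image, add_comm]
  rfl

end Counting

namespace Subcomplex

theorem ncard_interiorVerts_add [Finite δ] (K : M.Subcomplex) :
    K.interiorVerts.ncard + K.boundaryVerts.ncard = K.verts.ncard :=
  Set.ncard_sdiff_add_ncard_of_subset (Set.sep_subset _ _)

theorem ncard_interiorEdges_add [Finite δ] (K : M.Subcomplex) :
    K.interiorEdges.ncard + K.boundaryEdges.ncard = K.edges.ncard :=
  Set.ncard_sdiff_add_ncard_of_subset (Set.sep_subset _ _)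

theorem boundary_of_closedWalk {K : M.Subcomplex} {m : ℕ} (hm : 2 < m) {a : ZMod m → δ}
    (hinj : Function.Injective fun i => M.vertex (a i))
    (hstep : ∀ i, M.vertex (M.flip (a i)) = M.vertex (a (i + 1)))
    (hverts : Set.range (fun i => M.vertex (a i)) = K.boundaryVerts)
    (hedges : Set.range (fun i => M.edge (a i)) = K.boundaryEdges) :
    K.BoundaryIsCircle ∧ K.boundaryVerts.ncard = m ∧ K.boundaryEdges.ncard = m := by
  have hinj' : Function.Injective fun i => M.edge (a i) := by
    intro i j hij
    rcases M.eq_or_eq_flip hij with h | h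
    · exact hinj (congrArg M.vertex h.symm)
    · have hj : j = i + 1 := hinj ((congrArg M.vertex h).trans (hstep i))
      have h' : a i = M.flip (a j) := by rw [h, M.flip_flip]
      have hi : i = j + 1 := hinj ((congrArg M.vertex h').trans (hstep j))
      have h2 : ((2 : ℕ) : ZMod m) = 0 := by
        push_cast
        linear_combination -hi - hj
      exact absurd (Nat.le_of_dvd two_pos ((ZMod.natCast_eq_zero_iff 2 m).1 h2)) (by omega)
  have ncard_range {β : Type _} {f : ZMod m → β} (hf : Function.Injective f) :
      (Set.range f).ncard = m :=
    (Nat.card_range_of_injective hf).trans (Nat.card_zmod m)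
  exact ⟨⟨m, by omega, _, _, hinj, hinj', hverts, hedges, fun i => ⟨a i, rfl, rfl, hstep i⟩⟩,
    hverts ▸ ncard_range hinj, hedges ▸ ncard_range hinj'⟩

end Subcomplex

variable {R : M.Face}

theorem dualFace_mem_faces_awayFrom {v : M.Vertex} :
    M.dualFace v ∈ (M.dual.awayFrom (M.dualVertex R)).faces ↔ ¬ M.IsCorner v R :=
  not_congr isCorner_dualFace

theorem mem_boundaryVerts_dual_awayFrom {f : M.Face} :
    M.dualVertex f ∈ (M.dual.awayFrom (M.dualVertex R)).boundaryVerts ↔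
      f ≠ R ∧ ∃ v, M.IsCorner v R ∧ M.IsCorner v f := by
  refine and_congr_right' (M.dualFace.surjective.exists.trans (exists_congr fun v => ?_))
  rw [dualFace_mem_faces_awayFrom, not_not, isCorner_dualFace]

theorem mem_boundaryEdges_dual_awayFrom {e : M.Edge} :
    e ∈ (M.dual.awayFrom (M.dualVertex R)).boundaryEdges ↔
      ∃ d, M.edge d = e ∧ M.face d ≠ R ∧ M.face (M.flip d) ≠ R ∧ M.IsCorner (M.vertex d) R := by
  constructor
  · rintro ⟨he, g, hg, d, rfl, rfl⟩
    obtain ⟨h, h'⟩ := mem_edges_awayFrom.1 he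
    rw [← M.flip_flip d, ← dualFace_vertex, dualFace_mem_faces_awayFrom, not_not] at hg
    exact ⟨M.flip d, M.edge_flip d, h', (M.flip_flip d).symm ▸ h, hg⟩
  · rintro ⟨d, rfl, h, h', hd⟩
    exact ⟨mem_edges_awayFrom.2 ⟨h, h'⟩, M.dualFace (M.vertex d),
      fun hg => dualFace_mem_faces_awayFrom.1 hg hd, M.flip d, M.edge_flip d, rfl⟩

end CellMap

namespace DoodleDiagram

/-! ### Consequences of 3-connectivity -/

variable {δ : Type*} {D : DoodleDiagram δ}

theorem ncard_darts_at (v : D.Crossing) : {d | D.vertex d = v}.ncard = 4 := D.four_valent v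

section Connectivity

variable [Finite δ]

theorem minimalPeriod_rot (d : δ) : Function.minimalPeriod D.rot d = 4 := by
  rw [← D.valency_vertex, D.four_valent]

theorem rot_iterate_four (d : δ) : D.rot^[4] d = d := by
  simpa only [minimalPeriod_rot] using Function.iterate_minimalPeriod (f := D.rot) (x := d)

theorem rot_iterate_inj {d : δ} {i j : ℕ} (hi : i < 4) (hj : j < 4)
    (h : D.rot^[i] d = D.rot^[j] d) : i = j :=
  Function.iterate_injOn_Iio_minimalPeriod (by simpa [minimalPeriod_rot] using hi)
    (by simpa [minimalPeriod_rot] using hj) h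

theorem rot_ne (d : δ) : D.rot d ≠ d := fun h =>
  absurd (rot_iterate_inj (i := 1) (j := 0) (by norm_num) (by norm_num) h) one_ne_zero

theorem exists_rot_iterate {d y : δ} (h : D.vertex d = D.vertex y) :
    ∃ i < 4, D.rot^[i] d = y := by
  simpa only [minimalPeriod_rot] using D.exists_rot_iterate_eq h

namespace IsPrime

theorem exists_end_notMem (hprime : D.IsPrime) {x y z : δ}
    (hxy : x ≠ y) (hxz : x ≠ z) (hyz : y ≠ z)
    (hy : D.vertex y = D.vertex x) (hz : D.vertex z = D.vertex x) (w : D.Crossing) :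
    ∃ t ∈ ({x, y, z} : Set δ), D.vertex (D.flip t) ∉ ({D.vertex x, w} : Set D.Crossing) := by
  by_contra! hends
  set rest : Set δ := {d | D.vertex d = D.vertex x} \ {x, y, z}
  have hrest : rest.ncard = 1 := by
    rw [Set.ncard_sdiff (by rintro d (rfl | rfl | rfl) <;> first | exact rfl | assumption),
      ncard_darts_at, Set.ncard_eq_three.2 ⟨x, y, z, hxy, hxz, hyz, rfl⟩]
  have hS : (insert w ((fun d => D.vertex (D.flip d)) '' rest)).ncard < 3 := by
    have h1 := Set.ncard_insert_le w ((fun d => D.vertex (D.flip d)) '' rest)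
    have h2 := Set.ncard_image_le (f := fun d => D.vertex (D.flip d)) rest.toFinite
    omega
  obtain ⟨_, hu, hne, _, d, rfl, hd, rfl⟩ :=
    exists_adj_notMem_of_isKConnected hprime hS (D.vertex x)
  by_cases hdrest : d ∈ ({x, y, z} : Set δ)
  · rcases hends d hdrest with h | h
    exacts [hne h.symm, hu (.inl h)]
  · exact hu (.inr ⟨d, ⟨hd, hdrest⟩, rfl⟩)

theorem vertex_flip_ne (hprime : D.IsPrime) (d : δ) : D.vertex (D.flip d) ≠ D.vertex d := by
  intro hloop
  obtain ⟨z, hz, hzd⟩ : ∃ z, D.vertex z = D.vertex d ∧ z ∉ ({d, D.flip d} : Set δ) :=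
    Set.exists_mem_notMem_of_ncard_lt_ncard (s := {d, D.flip d})
      (t := {z | D.vertex z = D.vertex d}) (by
        rw [ncard_darts_at, Set.ncard_pair (D.flip_ne d).symm]
        decide)
  simp only [Set.mem_insert_iff, Set.mem_singleton_iff, not_or] at hzd
  obtain ⟨t, rfl | rfl | rfl, ht⟩ := hprime.exists_end_notMem (D.flip_ne d).symm
    (Ne.symm hzd.1) (Ne.symm hzd.2) hloop hz (D.vertex (D.flip z))
  · exact ht (.inl hloop)
  · exact ht (.inl (by rw [D.flip_flip]))
  · exact ht (.inr rfl)

theorem eq_of_vertex_edge (hprime : D.IsPrime) {x y : δ} (hv : D.vertex x = D.vertex y)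
    (he : D.edge x = D.edge y) : y = x := by
  rcases D.eq_or_eq_flip he with h | rfl
  exacts [h, absurd hv.symm (hprime.vertex_flip_ne x)]

/-- The two edges form a Jordan curve, one side of which contains no crossing; `f` is a region on
that side. -/
theorem exists_face_of_parallel (hprime : D.IsPrime) {x y : δ} (hne : D.edge x ≠ D.edge y)
    (hv : D.vertex x = D.vertex y) (hw : D.vertex (D.flip x) = D.vertex (D.flip y)) :
    ∃ f, ∀ d, D.face d = f → D.vertex d ∈ ({D.vertex x, D.vertex (D.flip x)} : Set D.Crossing) ∧
      (D.edge d = D.edge x ∨ D.edge d = D.edge y → D.face (D.flip d) ≠ f) := by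
  obtain ⟨s, hs⟩ := D.planar.exists_face_labelling_of_parallel hne hv hw
  set T : Set D.Crossing := {D.vertex x, D.vertex (D.flip x)}
  have other_side_ne (d : δ) (hd : D.edge d = D.edge x ∨ D.edge d = D.edge y) :
      D.face (D.flip d) ≠ D.face d := fun h => by
    have := (hs d).1 (congrArg s h.symm)
    tauto
  have label_eq_off {d z : δ} (hd : D.vertex d ∉ T) (hz : D.vertex z ∉ T) :
      s (D.face d) = s (D.face z) := by
    have mem_of_edge {u t : δ} (h : D.edge u = D.edge t) :
        D.vertex t ∈ ({D.vertex u, D.vertex (D.flip u)} : Set D.Crossing) := by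
      rcases D.eq_or_eq_flip h with rfl | rfl <;> simp
    have hT : T.ncard < 3 := (Set.ncard_insert_le _ _).trans_lt (by simp)
    refine CellMap.face_eq_of_preconnected_induce (hprime.2 T hT).preconnected s
      (fun t ht => (hs t).2 ⟨fun h => ht ?_, fun h => ht ?_⟩) hd hz
    · exact mem_of_edge h.symm
    · simpa only [T, hv, hw] using mem_of_edge h.symm
  by_cases hz : ∃ z, D.face z = D.face x ∧ D.vertex z ∉ T
  · obtain ⟨z, hzx, hz⟩ := hz
    refine ⟨D.face (D.flip x), fun d hd => ⟨?_, fun h => hd ▸ other_side_ne d h⟩⟩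
    by_contra hdT
    have h := label_eq_off hz hdT
    rw [hzx, hd, hs] at h
    exact h.1 rfl
  · push Not at hz
    exact ⟨D.face x, fun d hd => ⟨hz d hd, fun h => hd ▸ other_side_ne d h⟩⟩

theorem eq_of_parallel (hprime : D.IsPrime) (hmin : D.IsMinimal) {x y : δ}
    (hv : D.vertex x = D.vertex y) (hw : D.vertex (D.flip x) = D.vertex (D.flip y)) : x = y := by
  by_contra hne
  have hedge : D.edge x ≠ D.edge y := fun h => hne (hprime.eq_of_vertex_edge hv h).symm
  obtain ⟨f, hf⟩ := hprime.exists_face_of_parallel hedge hv hw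
  have end_mem (d : δ) (hd : D.face d = f) :
      D.vertex (D.flip d) ∈ ({D.vertex x, D.vertex (D.flip x)} : Set D.Crossing) := by
    rw [← D.vertex_turn d]
    exact (hf _ ((D.face_turn d).trans hd)).1
  have eq_or_eq_of_ends (d : δ) (hd : D.vertex d = D.vertex x)
      (hd' : D.vertex (D.flip d) = D.vertex (D.flip x)) : d = x ∨ d = y := by
    by_contra! h
    obtain ⟨t, rfl | rfl | rfl, ht⟩ := hprime.exists_end_notMem hne h.1.symm h.2.symm
      hv.symm hd (D.vertex (D.flip x))
    exacts [ht (.inr rfl), ht (.inr hw.symm), ht (.inr hd')]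
  have edge_mem (d : δ) (hd : D.face d = f) : D.edge d ∈ ({D.edge x, D.edge y} : Set D.Edge) := by
    have hloop := hprime.vertex_flip_ne d
    rcases (hf d hd).1 with h | h <;> rcases end_mem d hd with h' | h'
    · exact absurd (h'.trans h.symm) hloop
    · rcases eq_or_eq_of_ends d h h' with rfl | rfl <;> simp
    · rcases eq_or_eq_of_ends (D.flip d) h' (by rwa [D.flip_flip]) with h | h <;>
        simp [← h, D.edge_flip]
    · exact absurd (h'.trans h.symm) hloop
  have edge_injOn : Set.InjOn D.edge {d | D.face d = f} := by
    intro d hd d' hd' h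
    rcases D.eq_or_eq_flip h with rfl | rfl
    exacts [rfl, absurd hd' ((hf d hd).2 (edge_mem d hd))]
  have hsides : D.sides f ≤ 2 := calc
    {d | D.face d = f}.ncard ≤ ({D.edge x, D.edge y} : Set D.Edge).ncard :=
      Set.ncard_le_ncard_of_injOn D.edge edge_mem edge_injOn
    _ = 2 := Set.ncard_pair hedge
  have := hmin f
  omega

theorem exists_crossing_labelling (hprime : D.IsPrime) {S : Set D.Crossing} (hS : S.ncard < 3)
    {c : D.Edge → ZMod 2} (hc : D.incidence D.face *ᵥ c = 0)
    (hcS : ∀ d, D.vertex d ∉ S → D.vertex (D.flip d) ∉ S → c (D.edge d) = 0) :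
    ∃ s : D.Crossing → ZMod 2, (∀ v ∉ S, s v = 0) ∧
      ∀ d, c (D.edge d) = s (D.vertex d) + s (D.vertex (D.flip d)) := by
  obtain ⟨s, hs⟩ := D.planar.exists_vertex_labelling hc
  obtain ⟨u, hu⟩ := (hprime.2 S hS).nonempty
  refine ⟨fun v => s v + s u, fun v hv => CharTwo.add_eq_zero.2 ?_, fun d => ?_⟩
  · refine CellMap.eq_of_preconnected_induce (hprime.2 S hS).preconnected s (fun d h h' => ?_) hv hu
    rw [← CharTwo.add_eq_zero, ← hs, hcS d h h']
  · rw [add_add_add_comm, CharTwo.add_self_eq_zero, add_zero, hs]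

theorem arcChain_edge_rot_iterate (hprime : D.IsPrime) (d : δ) {j k : ℕ} (hj : j < 4) (hk : k ≤ 4) :
    D.arcChain d k (D.edge (D.rot^[j + 1] d)) = if j < k then 1 else 0 := by
  classical
  have hedge : ∀ i ∈ Finset.range k,
      (D.edge (D.rot^[i + 1] d) = D.edge (D.rot^[j + 1] d) ↔ i = j) := by
    refine fun i hi => ⟨fun h => ?_, fun h => h ▸ rfl⟩
    have hrot := hprime.eq_of_vertex_edge (by simp only [D.vertex_rot_iterate]) h
    rw [Function.iterate_succ_apply', Function.iterate_succ_apply', D.rot.injective.eq_iff] at hrot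
    exact (rot_iterate_inj hj (by grind) hrot).symm
  rw [D.arcChain_apply, Finset.sum_congr rfl fun i hi => if_congr (hedge i hi) rfl rfl,
    Finset.sum_ite_eq']
  simp

theorem eq_of_vertex_face (hprime : D.IsPrime) {d d' : δ} (hv : D.vertex d = D.vertex d')
    (hf : D.face d = D.face d') : d = d' := by
  obtain ⟨k, hk, rfl⟩ := exists_rot_iterate hv
  obtain ⟨s, hs, hcs⟩ := hprime.exists_crossing_labelling (S := {D.vertex d})
    (by simp) (c := D.arcChain d k) (by
      rw [D.incidence_face_mulVec_arcChain, hf]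
      exact ZModModule.add_self _) (fun y h h' => D.arcChain_eq_zero k h h')
  have h_value (j : ℕ) (hj : j < 4) : (if j < k then 1 else 0) = s (D.vertex d) := by
    rw [← hprime.arcChain_edge_rot_iterate d hj hk.le, hcs, hs (D.vertex (D.flip _)), add_zero,
      D.vertex_rot_iterate]
    rw [← D.vertex_rot_iterate (j + 1) d]
    exact hprime.vertex_flip_ne _
  obtain rfl : k = 0 := by
    have h03 := (h_value 0 (by norm_num)).trans (h_value 3 (by norm_num)).symm
    by_contra hk0
    rw [if_pos (Nat.pos_of_ne_zero hk0), if_neg (by omega)] at h03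
    exact one_ne_zero h03
  rfl

theorem face_flip_ne (hprime : D.IsPrime) (d : δ) : D.face (D.flip d) ≠ D.face d := by
  intro h
  have hturn : D.turn d = D.flip d :=
    hprime.eq_of_vertex_face (D.vertex_turn d) ((D.face_turn d).trans h.symm)
  exact rot_ne (D.flip d) (hturn ▸ D.rot_turn d)

theorem edge_injOn_face (hprime : D.IsPrime) (f : D.Region) :
    Set.InjOn D.edge {d | D.face d = f} := by
  intro d hd d' hd' h
  rcases D.eq_or_eq_flip h with rfl | rfl
  exacts [rfl, absurd (hd'.trans hd.symm) (hprime.face_flip_ne d)]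

/-- A closed curve through the two crossings and the two regions separates the `k` darts after `x`
from the remaining darts at that crossing, and one of its sides contains no crossing. -/
theorem arc_ends_eq (hprime : D.IsPrime) {x y : δ} {k l : ℕ} (hk : k ≤ 4)
    (hv : D.vertex x ≠ D.vertex y) (hf : D.face x = D.face y)
    (hg : D.face (D.rot^[k] x) = D.face (D.rot^[l] y)) :
    (∀ i < k, D.vertex (D.flip (D.rot^[i + 1] x)) = D.vertex y) ∨
      ∀ i < 4, k ≤ i → D.vertex (D.flip (D.rot^[i + 1] x)) = D.vertex y := by
  obtain ⟨s, hs, hcs⟩ := hprime.exists_crossing_labelling (S := {D.vertex x, D.vertex y})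
    (c := D.arcChain x k + D.arcChain y l)
    (by rw [Set.ncard_pair hv]; decide)
    (by
      rw [mulVec_add, D.incidence_face_mulVec_arcChain, D.incidence_face_mulVec_arcChain, hf, hg]
      exact ZModModule.add_self _)
    (fun d h h' => by
      simp only [Set.mem_insert_iff, Set.mem_singleton_iff, not_or] at h h'
      rw [Pi.add_apply, D.arcChain_eq_zero k h.1 h'.1, D.arcChain_eq_zero l h.2 h'.2, add_zero])
  have h_value {i : ℕ} (hi : i < 4) (hend : D.vertex (D.flip (D.rot^[i + 1] x)) ≠ D.vertex y) :
      (if i < k then 1 else 0) = s (D.vertex x) := by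
    have hvi := D.vertex_rot_iterate (i + 1) x
    have hloop := hprime.vertex_flip_ne (D.rot^[i + 1] x)
    have h := hcs (D.rot^[i + 1] x)
    rw [hvi] at hloop
    rwa [Pi.add_apply, hprime.arcChain_edge_rot_iterate x hi hk,
      D.arcChain_eq_zero l (by rwa [hvi]) hend, hvi,
      hs (D.vertex (D.flip _)) (fun h => h.elim hloop hend), add_zero, add_zero] at h
  by_contra! h
  obtain ⟨⟨i, hi, hi'⟩, j, hj, hkj, hj'⟩ := h
  have hij := (h_value (hi.trans_le hk) hi').trans (h_value hj hj').symm
  rw [if_pos hi, if_neg hkj.not_gt] at hij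
  exact one_ne_zero hij

theorem exists_common_edge (hprime : D.IsPrime) (hmin : D.IsMinimal) {f g : D.Region}
    {v w : D.Crossing} (hfg : f ≠ g) (hvw : v ≠ w) (hvf : D.IsCorner v f) (hvg : D.IsCorner v g)
    (hwf : D.IsCorner w f) (hwg : D.IsCorner w g) :
    ∃ x, D.face x = f ∧ D.face (D.flip x) = g ∧
      (D.vertex x = v ∧ D.vertex (D.flip x) = w ∨ D.vertex x = w ∧ D.vertex (D.flip x) = v) := by
  obtain ⟨a, rfl, rfl⟩ := hvf
  obtain ⟨a', rfl, ha⟩ := hvg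
  obtain ⟨b, hbf, rfl⟩ := hwf
  obtain ⟨b', hbg, hb⟩ := hwg
  obtain ⟨k, hk, rfl⟩ := exists_rot_iterate ha.symm
  obtain ⟨l, -, rfl⟩ := exists_rot_iterate hb.symm
  have eq_of_ends {i j : ℕ} (hi : i < 4) (hj : j < 4)
      (hi' : D.vertex (D.flip (D.rot^[i + 1] a)) = D.vertex b)
      (hj' : D.vertex (D.flip (D.rot^[j + 1] a)) = D.vertex b) : i = j := by
    have h := hprime.eq_of_parallel hmin (by simp only [D.vertex_rot_iterate]) (hi'.trans hj'.symm)
    rw [Function.iterate_succ_apply', Function.iterate_succ_apply', D.rot.injective.eq_iff] at h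
    exact rot_iterate_inj hi hj h
  have hk0 : k ≠ 0 := by
    rintro rfl
    exact hfg rfl
  rcases hprime.arc_ends_eq hk.le hvw hbf.symm hbg.symm with h | h
  · obtain rfl : k = 1 := by
      by_contra hk1
      exact absurd (eq_of_ends (i := 0) (j := 1) (by norm_num) (by norm_num)
        (h 0 (by omega)) (h 1 (by omega))) zero_ne_one
    refine ⟨D.flip (D.rot a), D.face_flip_rot a, ?_, .inr ⟨h 0 one_pos, ?_⟩⟩
    · rw [D.flip_flip]; rfl
    · rw [D.flip_flip, D.vertex_rot]
  · have hrot := rot_iterate_four (D := D) a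
    obtain rfl : k = 3 := by
      by_contra hk3
      exact absurd (eq_of_ends (i := 2) (j := 3) (by norm_num) (by norm_num)
        (h 2 (by norm_num) (by omega)) (h 3 (by norm_num) (by omega))) (by norm_num)
    have ha_rot : D.rot (D.rot^[3] a) = a :=
      (Function.iterate_succ_apply' D.rot 3 a).symm.trans hrot
    refine ⟨a, rfl, ?_, .inl ⟨rfl, ?_⟩⟩
    · rw [← D.face_flip_rot (D.rot^[3] a), ha_rot]
    · rw [← h 3 (by norm_num) le_rfl, hrot]

theorem rot_eq_of_face_flip (hprime : D.IsPrime) {d d' : δ} (hv : D.vertex d = D.vertex d')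
    (hf : D.face d = D.face (D.flip d')) : D.rot d = d' := by
  obtain ⟨y, rfl⟩ := D.rot.surjective d'
  rw [hprime.eq_of_vertex_face (hv.trans (D.vertex_rot y)) (hf.trans (D.face_flip_rot y))]

theorem rot_eq_or_rot_eq_of_isCorner (hprime : D.IsPrime) (hmin : D.IsMinimal) {d d' : δ}
    {w : D.Crossing} (hv : D.vertex d = D.vertex d') (hf : D.face d ≠ D.face d')
    (hw : w ≠ D.vertex d) (hwd : D.IsCorner w (D.face d)) (hwd' : D.IsCorner w (D.face d')) :
    D.rot d = d' ∨ D.rot d' = d := by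
  obtain ⟨x, hx, hx', ⟨hxv, -⟩ | ⟨-, hxv⟩⟩ := hprime.exists_common_edge hmin hf hw.symm
    (D.isCorner_face d) (hv ▸ D.isCorner_face d') hwd hwd'
  · obtain rfl := hprime.eq_of_vertex_face hxv hx
    exact .inr (hprime.rot_eq_of_face_flip hv.symm hx'.symm)
  · obtain rfl := hprime.eq_of_vertex_face (hxv.trans hv) hx'
    exact .inl (hprime.rot_eq_of_face_flip hv (by rw [D.flip_flip, hx]))

theorem vertex_ne_vertex_flip (hprime : D.IsPrime) {d d' : δ} (hf : D.face d = D.face d')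
    (hf' : D.face (D.flip d) = D.face (D.flip d')) : D.vertex d' ≠ D.vertex (D.flip d) := by
  intro hv
  have h1 : D.rot (D.flip d) = d' := hprime.rot_eq_of_face_flip hv.symm hf'
  have h2 : D.rot d' = D.flip d := hprime.rot_eq_of_face_flip hv (by rw [D.flip_flip, hf])
  have h : D.rot^[2] d' = D.rot^[0] d' := (congrArg D.rot h2).trans h1
  exact absurd (rot_iterate_inj (by norm_num) (by norm_num) h) two_ne_zero

theorem eq_of_face_face_flip (hprime : D.IsPrime) (hmin : D.IsMinimal) {d d' : δ}
    (hf : D.face d = D.face d') (hf' : D.face (D.flip d) = D.face (D.flip d')) : d = d' := by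
  by_contra hne
  have hv : D.vertex d ≠ D.vertex d' := fun h => hne (hprime.eq_of_vertex_face h hf)
  have isCorner_flip (y : δ) : D.IsCorner (D.vertex y) (D.face (D.flip y)) := by
    simpa only [D.flip_flip] using D.isCorner_flip_face (D.flip y)
  obtain ⟨x, hx, -, ⟨hstart, hend⟩ | ⟨hstart, hend⟩⟩ := hprime.exists_common_edge hmin
    (hprime.face_flip_ne d).symm hv (D.isCorner_face d) (isCorner_flip d)
    (hf ▸ D.isCorner_face d') (hf' ▸ isCorner_flip d')
  · obtain rfl := hprime.eq_of_vertex_face hstart hx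
    exact hprime.vertex_ne_vertex_flip hf hf' hend.symm
  · obtain rfl := hprime.eq_of_vertex_face hstart (hx.trans hf)
    exact hprime.vertex_ne_vertex_flip hf.symm hf'.symm hend.symm

/-- Otherwise the region between the first two of these darts and the region between the last two
both share an edge with `R`, which leaves only three edges at the end of `D.rot x`. -/
theorem not_isCorner_flip_rot_rot (hprime : D.IsPrime) (hmin : D.IsMinimal) {R : D.Region} {x : δ}
    (hx : ¬ D.IsCorner (D.vertex x) R) (h₀ : D.IsCorner (D.vertex (D.flip x)) R)
    (h₁ : D.IsCorner (D.vertex (D.flip (D.rot x))) R) :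
    ¬ D.IsCorner (D.vertex (D.flip (D.rot (D.rot x)))) R := by
  intro h₂
  obtain ⟨t, rfl, ht⟩ := h₁
  have face_ne {y : δ} (hy : D.vertex y = D.vertex x) : D.face y ≠ D.face t :=
    fun h => hx ⟨y, h, hy⟩
  have end_ne {y y' : δ} (hy : D.vertex y = D.vertex y') (hne : y ≠ y') :
      D.vertex (D.flip y) ≠ D.vertex (D.flip y') :=
    fun h => hne (hprime.eq_of_parallel hmin hy h)
  have h_left : D.rot (D.flip (D.rot x)) = t := by
    refine (hprime.rot_eq_or_rot_eq_of_isCorner hmin ht.symm ?_ (end_ne (D.vertex_rot x).symm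
      (rot_ne x).symm) ?_ h₀).resolve_right fun h => face_ne (D.vertex_rot x) ?_
    · rw [D.face_flip_rot]
      exact face_ne rfl
    · rw [D.face_flip_rot]
      exact D.isCorner_flip_face x
    · rw [← D.face_turn, D.rot.injective ((D.rot_turn _).trans h.symm)]
  have h_right : D.rot t = D.turn (D.rot x) := by
    refine (hprime.rot_eq_or_rot_eq_of_isCorner hmin ((D.vertex_turn _).trans ht.symm) ?_ ?_ ?_
      h₂).resolve_left fun h => face_ne rfl ?_
    · rw [D.face_turn]
      exact face_ne (D.vertex_rot x)
    · rw [D.vertex_turn]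
      exact end_ne (D.vertex_rot _) (rot_ne _)
    · rw [D.face_turn, ← D.face_flip_rot]
      exact D.isCorner_face _
    · rw [← D.face_flip_rot, ← h, D.rot_turn]
  have h : D.rot^[3] t = D.rot^[0] t := by
    change D.rot (D.rot (D.rot t)) = t
    rw [h_right, D.rot_turn, h_left]
  exact absurd (rot_iterate_inj (by norm_num) (by norm_num) h) three_ne_zero

theorem exists_not_isCorner_flip (hprime : D.IsPrime) (hmin : D.IsMinimal) {R : D.Region} {x : δ}
    (hx : ¬ D.IsCorner (D.vertex x) R) :
    ∃ i < 3, ¬ D.IsCorner (D.vertex (D.flip (D.rot^[i] x))) R := by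
  by_contra! h
  exact hprime.not_isCorner_flip_rot_rot hmin hx (h 0 (by norm_num)) (h 1 (by norm_num))
    (h 2 (by norm_num))

theorem exists_two_not_isCorner_flip (hprime : D.IsPrime) (hmin : D.IsMinimal) {R : D.Region}
    {x : δ} (hx : ¬ D.IsCorner (D.vertex x) R) :
    ∃ y z, y ≠ z ∧ D.vertex y = D.vertex x ∧ D.vertex z = D.vertex x ∧
      ¬ D.IsCorner (D.vertex (D.flip y)) R ∧ ¬ D.IsCorner (D.vertex (D.flip z)) R := by
  obtain ⟨i, -, hi⟩ := hprime.exists_not_isCorner_flip hmin hx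
  obtain ⟨j, hj, hj'⟩ := hprime.exists_not_isCorner_flip hmin (x := D.rot^[i + 1] x)
    (by rwa [D.vertex_rot_iterate])
  rw [Function.iterate_succ_apply', ← Function.iterate_succ_apply] at hj'
  refine ⟨_, _, fun h => ?_, D.vertex_rot_iterate i x,
    (D.vertex_rot_iterate _ _).trans (D.vertex_rot_iterate i x), hi, hj'⟩
  exact absurd (rot_iterate_inj (i := 0) (by norm_num) (by omega) h) (by omega)

end IsPrime

end Connectivity

/-! ### The ring around a region -/

/-- The closed walk in the dual graph around the region on the left of `d`. At each dart `y` of the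
boundary of that region it takes two steps: it crosses the dart opposite to `y` at the crossing from
which `y` leaves, and then the dart after that one. -/
def ringDart (D : DoodleDiagram δ) (d : δ) (k : ℕ) : δ :=
  D.flip (D.rot^[k % 2 + 2] (D.turn^[k / 2] d))

theorem face_ringDart (d : δ) (k : ℕ) :
    D.face (D.ringDart d k) = D.face (D.rot^[k % 2 + 1] (D.turn^[k / 2] d)) :=
  D.face_flip_rot_iterate _ _

/-- The complement in the dual of the open star of the region `R`, that is, the subcomplex `Δ` when
`R` is the infinite region. -/
abbrev finitePart (D : DoodleDiagram δ) (R : D.Region) : D.dualGraph.Subcomplex :=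
  D.dualGraph.awayFrom (D.regionVertex R)

section Ring

variable [Finite δ]

theorem face_rot_iterate_three (d : δ) : D.face (D.rot^[3] d) = D.face (D.flip d) := by
  rw [← D.face_flip_rot_iterate, rot_iterate_four]

theorem face_flip_ringDart (d : δ) (k : ℕ) :
    D.face (D.flip (D.ringDart d k)) = D.face (D.ringDart d (k + 1)) := by
  rw [face_ringDart, ringDart, D.flip_flip]
  obtain ⟨q, rfl | rfl⟩ := Nat.even_or_odd' k
  · rw [show 2 * q % 2 = 0 by omega, show (2 * q + 1) % 2 = 1 by omega,
      show 2 * q / 2 = (2 * q + 1) / 2 by omega]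
  · rw [show (2 * q + 1) % 2 = 1 by omega, show (2 * q + 1) / 2 = q by omega,
      show (2 * q + 1 + 1) % 2 = 0 by omega, show (2 * q + 1 + 1) / 2 = q + 1 by omega,
      face_rot_iterate_three, ← D.rot_turn, Function.iterate_succ_apply' D.turn]
    rfl

theorem minimalPeriod_turn (d : δ) :
    Function.minimalPeriod D.turn d = D.sides (D.face d) :=
  (D.dual.valency_vertex d).symm

theorem ringDart_periodic (d : δ) : Function.Periodic (D.ringDart d) (2 * D.sides (D.face d)) := by
  intro k
  rw [ringDart, Nat.add_mul_mod_self_left, Nat.add_mul_div_left _ _ two_pos,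
    Function.iterate_add_apply D.turn, ← minimalPeriod_turn, Function.iterate_minimalPeriod]
  rfl

theorem exists_ringDart_eq {d y : δ} (hy : D.face d = D.face y) {j : ℕ} (hj : j < 2) :
    ∃ k, D.ringDart d k = D.flip (D.rot^[j + 2] y) := by
  obtain ⟨i, -, rfl⟩ := D.dual.exists_rot_iterate_eq hy
  refine ⟨j + 2 * i, ?_⟩
  rw [ringDart, Nat.add_mul_mod_self_left, Nat.mod_eq_of_lt hj, Nat.add_mul_div_left _ _ two_pos,
    Nat.div_eq_of_lt hj, zero_add]
  rfl

theorem exists_face_ringDart_eq {d y : δ} (hy : D.face d = D.face y) {i : ℕ} (hi : i ≠ 0)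
    (hi' : i < 4) : ∃ k, D.face (D.ringDart d k) = D.face (D.rot^[i] y) := by
  obtain rfl | hi1 := eq_or_ne i 1
  · obtain ⟨k, hk⟩ := exists_ringDart_eq hy two_pos
    exact ⟨k, by rw [hk, D.face_flip_rot_iterate]⟩
  · obtain ⟨k, hk⟩ := exists_ringDart_eq hy (j := i - 2) (by omega)
    refine ⟨k + 1, ?_⟩
    rw [← face_flip_ringDart, hk, D.flip_flip, Nat.sub_add_cancel (by omega)]

namespace IsPrime

theorem face_rot_iterate_inj (hprime : D.IsPrime) {d : δ} {i j : ℕ} (hi : i < 4) (hj : j < 4)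
    (h : D.face (D.rot^[i] d) = D.face (D.rot^[j] d)) : i = j :=
  rot_iterate_inj hi hj (hprime.eq_of_vertex_face (by simp only [D.vertex_rot_iterate]) h)

theorem face_rot_iterate_ne (hprime : D.IsPrime) (d : δ) {i : ℕ} (hi : i ≠ 0) (hi' : i < 4) :
    D.face (D.rot^[i] d) ≠ D.face d :=
  fun h => hi (hprime.face_rot_iterate_inj (j := 0) hi' four_pos h)

theorem face_ringDart_ne (hprime : D.IsPrime) (d : δ) (k : ℕ) :
    D.face (D.ringDart d k) ≠ D.face d := by
  rw [face_ringDart, ← D.face_turn_iterate (k / 2) d]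
  exact hprime.face_rot_iterate_ne _ (by omega) (by omega)

theorem range_vertex_ringDart (hprime : D.IsPrime) (d : δ) :
    Set.range (fun k => D.dualGraph.vertex (D.ringDart d k)) =
      (D.finitePart (D.face d)).boundaryVerts := by
  refine Set.Subset.antisymm (Set.range_subset_iff.2 fun k => ?_) fun f hf => ?_
  · exact CellMap.mem_boundaryVerts_dual_awayFrom.2 ⟨hprime.face_ringDart_ne d k,
      D.vertex (D.turn^[k / 2] d), ⟨_, D.face_turn_iterate _ d, rfl⟩,
      _, (face_ringDart d k).symm, D.vertex_rot_iterate _ _⟩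
  · obtain ⟨hne, v, ⟨y, hy, rfl⟩, x, rfl, hv⟩ := CellMap.mem_boundaryVerts_dual_awayFrom.1 hf
    obtain ⟨i, hi, rfl⟩ := exists_rot_iterate hv.symm
    refine exists_face_ringDart_eq hy.symm ?_ hi
    rintro rfl
    exact hne hy

theorem range_edge_ringDart (hprime : D.IsPrime) (d : δ) :
    Set.range (fun k => D.dualGraph.edge (D.ringDart d k)) =
      (D.finitePart (D.face d)).boundaryEdges := by
  refine Set.Subset.antisymm (Set.range_subset_iff.2 fun k => ?_) fun e he => ?_
  · refine CellMap.mem_boundaryEdges_dual_awayFrom.2 ⟨D.flip (D.ringDart d k), D.edge_flip _,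
      ?_, ?_, D.turn^[k / 2] d, D.face_turn_iterate _ d, ?_⟩
    · rw [face_flip_ringDart]
      exact hprime.face_ringDart_ne d _
    · rw [D.flip_flip]
      exact hprime.face_ringDart_ne d _
    · rw [ringDart, D.flip_flip, D.vertex_rot_iterate]
  · obtain ⟨x, rfl, hx, hx', y, hy, hv⟩ := CellMap.mem_boundaryEdges_dual_awayFrom.1 he
    obtain ⟨i, hi, rfl⟩ := exists_rot_iterate hv
    have hi0 : i ≠ 0 := by
      rintro rfl
      exact hx hy
    have hi1 : i ≠ 1 := by
      rintro rfl
      exact hx' ((D.face_flip_rot y).trans hy)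
    obtain ⟨k, hk⟩ := exists_ringDart_eq hy.symm (j := i - 2) (by omega)
    rw [Nat.sub_add_cancel (by omega)] at hk
    exact ⟨k, (congrArg D.edge hk).trans (D.edge_flip _)⟩

theorem eq_and_eq_of_face_rot_iterate (hprime : D.IsPrime) (hmin : D.IsMinimal) {y y' : δ}
    {j j' : ℕ} (hy : D.face y = D.face y') (hj : j < 2) (hj' : j' < 2)
    (h : D.face (D.rot^[j + 1] y) = D.face (D.rot^[j' + 1] y')) : y = y' ∧ j = j' := by
  have hyy' : y = y' := by
    by_contra hne
    obtain ⟨x, hx, hx', ⟨hv, -⟩ | ⟨hv, -⟩⟩ := hprime.exists_common_edge hmin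
      (hprime.face_rot_iterate_ne y (i := j + 1) (by omega) (by omega)).symm
      (fun hv => hne (hprime.eq_of_vertex_face hv hy)) (D.isCorner_face y)
      ⟨_, rfl, D.vertex_rot_iterate _ _⟩ (hy ▸ D.isCorner_face y')
      ⟨_, h.symm, D.vertex_rot_iterate _ _⟩
    · obtain rfl := hprime.eq_of_vertex_face hv hx
      rw [← face_rot_iterate_three] at hx'
      exact absurd (hprime.face_rot_iterate_inj (by norm_num) (by omega) hx') (by omega)
    · obtain rfl := hprime.eq_of_vertex_face hv (hx.trans hy)
      rw [← face_rot_iterate_three, h] at hx'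
      exact absurd (hprime.face_rot_iterate_inj (by norm_num) (by omega) hx') (by omega)
  subst hyy'
  exact ⟨rfl, Nat.succ_injective (hprime.face_rot_iterate_inj (by omega) (by omega) h)⟩

theorem face_ringDart_injOn (hprime : D.IsPrime) (hmin : D.IsMinimal) (d : δ) :
    Set.InjOn (fun k => D.face (D.ringDart d k)) (Set.Iio (2 * D.sides (D.face d))) := by
  intro k hk l hl h
  rw [Set.mem_Iio] at hk hl
  simp only [face_ringDart] at h
  obtain ⟨hturn, hmod⟩ := hprime.eq_and_eq_of_face_rot_iterate hmin
    ((D.face_turn_iterate _ d).trans (D.face_turn_iterate _ d).symm)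
    (Nat.mod_lt k two_pos) (Nat.mod_lt l two_pos) h
  have hdiv : k / 2 = l / 2 := by
    refine Function.iterate_injOn_Iio_minimalPeriod ?_ ?_ hturn <;>
      rw [Set.mem_Iio, minimalPeriod_turn] <;> omega
  omega

theorem boundary_finitePart (hprime : D.IsPrime) (hmin : D.IsMinimal) (R : D.Region) :
    (D.finitePart R).BoundaryIsCircle ∧
      (D.finitePart R).boundaryVerts.ncard = 2 * D.sides R ∧
      (D.finitePart R).boundaryEdges.ncard = 2 * D.sides R := by
  obtain ⟨d, rfl⟩ := D.face_surjective R
  set m := 2 * D.sides (D.face d)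
  have hm : 2 < m := by
    have := hmin (D.face d)
    omega
  have : NeZero m := ⟨by omega⟩
  have hper (k : ℕ) : D.ringDart d (k : ZMod m).val = D.ringDart d k := by
    rw [ZMod.val_natCast, (ringDart_periodic d).map_mod_nat]
  have range_val {β : Type _} (f : δ → β) : Set.range (fun i : ZMod m => f (D.ringDart d i.val)) =
      Set.range fun k => f (D.ringDart d k) :=
    Set.Subset.antisymm (Set.range_comp_subset_range ZMod.val fun k => f (D.ringDart d k))
      (Set.range_subset_iff.2 fun k => ⟨k, congrArg f (hper k)⟩)
  refine CellMap.Subcomplex.boundary_of_closedWalk hm (a := fun i => D.ringDart d i.val)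
    (fun i j h => ZMod.val_injective m
      (hprime.face_ringDart_injOn hmin d (ZMod.val_lt i) (ZMod.val_lt j) h))
    (fun i => ?_) ((range_val _).trans (hprime.range_vertex_ringDart d))
    ((range_val _).trans (hprime.range_edge_ringDart d))
  have hsucc : i + 1 = ((i.val + 1 : ℕ) : ZMod m) := by simp
  rw [hsucc, hper]
  exact face_flip_ringDart d i.val

end IsPrime

end Ring

/-! ### The finite part of the dual -/

theorem ncard_valency_finitePart (R : D.Region) (i : ℕ) :
    {v ∈ (D.finitePart R).verts | D.dualGraph.valency v = i}.ncard =
      ({f | D.sides f = i} \ {R} : Set D.Region).ncard :=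
  congrArg Set.ncard (Set.ext fun _ => and_comm)

theorem ncard_valency_finitePart_of_ne {R : D.Region} {i : ℕ} (hi : i ≠ D.sides R) :
    {v ∈ (D.finitePart R).verts | D.dualGraph.valency v = i}.ncard = D.numGons i := by
  rw [ncard_valency_finitePart, Set.sdiff_singleton_eq_self fun h => hi h.symm]
  rfl

theorem card_dual_face : Nat.card D.dualGraph.Face = Nat.card D.Crossing :=
  Nat.card_congr D.dualFace.symm

variable [Finite δ]

theorem ncard_valency_finitePart_self_add_one (R : D.Region) :
    {v ∈ (D.finitePart R).verts | D.dualGraph.valency v = D.sides R}.ncard + 1 =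
      D.numGons (D.sides R) := by
  rw [ncard_valency_finitePart]
  exact Set.ncard_sdiff_singleton_add_one (s := {f : D.Region | D.sides f = D.sides R}) (a := R) rfl

theorem card_edge : Nat.card D.Edge = 2 * Nat.card D.Crossing := by
  have h1 := CellMap.card_dart_eq_two_mul_card_edge (M := D.toCellMap)
  have h2 : Nat.card δ = 4 * Nat.card D.Crossing :=
    CellMap.card_dart_eq_mul_card_vertex D.four_valent
  omega

theorem card_region : Nat.card D.Region = Nat.card D.Crossing + 2 := by
  have h1 : Nat.card D.Crossing + Nat.card D.Region = Nat.card D.Edge + 2 :=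
    D.planar.card_vertex_add_card_face D.connected
  have h2 := D.card_edge
  omega

theorem ncard_verts_finitePart (R : D.Region) :
    (D.finitePart R).verts.ncard = Nat.card D.Crossing + 1 :=
  Nat.succ_injective ((CellMap.ncard_verts_awayFrom_add_one _).trans card_region)

namespace IsPrime

theorem dual_face_injOn_face (hprime : D.IsPrime) (f : D.Region) :
    Set.InjOn D.dualGraph.face {d | D.face d = f} := by
  intro d hd d' hd' h
  rw [← D.flip_flip d', ← CellMap.dualFace_vertex, CellMap.dual_face_eq_dualFace_iff,
    ← D.vertex_turn, ← D.vertex_turn] at h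
  exact D.turn.injective (hprime.eq_of_vertex_face h
    (by rw [D.face_turn, D.face_turn, hd, hd']))

theorem ncard_edges_finitePart_add (hprime : D.IsPrime) (R : D.Region) :
    (D.finitePart R).edges.ncard + D.sides R = 2 * Nat.card D.Crossing :=
  (CellMap.ncard_edges_awayFrom_add_valency (hprime.edge_injOn_face R)).trans card_edge

theorem ncard_faces_finitePart_add (hprime : D.IsPrime) (R : D.Region) :
    (D.finitePart R).faces.ncard + D.sides R = Nat.card D.Crossing :=
  (CellMap.ncard_faces_awayFrom_add_valency (hprime.dual_face_injOn_face R)).trans card_dual_face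

theorem ncard_interiorEdges_finitePart (hprime : D.IsPrime) (hmin : D.IsMinimal) (R : D.Region) :
    ((D.finitePart R).interiorEdges.ncard : ℤ) = 2 * Nat.card D.Crossing - 3 * D.sides R := by
  have h1 := (D.finitePart R).ncard_interiorEdges_add
  have h2 := (hprime.boundary_finitePart hmin R).2.2
  have h3 := hprime.ncard_edges_finitePart_add R
  omega

theorem ncard_interiorVerts_finitePart (hprime : D.IsPrime) (hmin : D.IsMinimal) (R : D.Region) :
    ((D.finitePart R).interiorVerts.ncard : ℤ) = Nat.card D.Crossing + 1 - 2 * D.sides R := by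
  have h1 := (D.finitePart R).ncard_interiorVerts_add
  have h2 := (hprime.boundary_finitePart hmin R).2.1
  have h3 := D.ncard_verts_finitePart R
  omega

theorem isFourSided_dual (hprime : D.IsPrime) (f : D.dualGraph.Face) :
    D.dualGraph.IsFourSided f := by
  obtain ⟨v, rfl⟩ := D.dualFace.surjective f
  refine ⟨(CellMap.sides_dualFace v).trans (D.four_valent v), fun d hd d' hd' h => ?_,
    fun d hd d' hd' h => hprime.dual_face_injOn_face _ rfl h.symm (hd.trans hd'.symm)⟩
  rcases D.eq_or_eq_flip h with rfl | rfl
  · rfl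
  · exact absurd (CellMap.dual_face_eq_dualFace_iff.1 (hd.trans hd'.symm))
      (hprime.vertex_flip_ne _)

theorem face_eq_of_ne_region (hprime : D.IsPrime) {α : Type*} {R : D.Region} {s : D.Region → α}
    (hs : ∀ d, D.face d ≠ R → D.face (D.flip d) ≠ R → s (D.face d) = s (D.face (D.flip d)))
    {f g : D.Region} (hf : f ≠ R) (hg : g ≠ R) : s f = s g := by
  classical
  obtain ⟨d₀, rfl⟩ := D.face_surjective R
  have h_step {z : δ} (hz : D.face z = D.face d₀) {i : ℕ} (hi : i ≠ 0) (hi' : i + 1 < 4) :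
      s (D.face (D.rot^[i + 1] z)) = s (D.face (D.rot^[i] z)) := by
    have h := hs (D.rot^[i + 1] z) (hz ▸ hprime.face_rot_iterate_ne z (by omega) hi')
    rw [D.face_flip_rot_iterate] at h
    exact h (hz ▸ hprime.face_rot_iterate_ne z hi (by omega))
  have h_around {y : δ} (hy : D.face d₀ = D.face y) :
      s (D.face (D.flip y)) = s (D.face (D.flip d₀)) := by
    refine CellMap.vertex_induction (M := D.dual)
      (P := fun y => s (D.face (D.flip y)) = s (D.face (D.flip d₀))) rfl (fun y hy h => ?_) hy
    have hturn : D.face (D.turn y) = D.face d₀ := (D.face_turn y).trans hy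
    calc s (D.face (D.flip (D.turn y)))
        = s (D.face (D.rot^[3] (D.turn y))) := by rw [face_rot_iterate_three]
      _ = s (D.face (D.rot^[1] (D.turn y))) :=
          (h_step hturn two_ne_zero (by norm_num)).trans (h_step hturn one_ne_zero (by norm_num))
      _ = s (D.face (D.flip d₀)) := by rw [Function.iterate_one, D.rot_turn, h]
  -- So all neighbours of the exceptional region agree, and it can be given their common value.
  have h_const := CellMap.face_eq_of_connected D.connected
    (Function.update s (D.face d₀) (s (D.face (D.flip d₀)))) (fun d => ?_) f g
  · rwa [Function.update_of_ne hf, Function.update_of_ne hg] at h_const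
  · have hne := hprime.face_flip_ne d
    by_cases hd : D.face d = D.face d₀
    · rw [hd, Function.update_self, Function.update_of_ne (hd ▸ hne), h_around hd.symm]
    by_cases hd' : D.face (D.flip d) = D.face d₀
    · rw [hd', Function.update_self, Function.update_of_ne hd, ← h_around hd'.symm, D.flip_flip]
    · rw [Function.update_of_ne hd, Function.update_of_ne hd', hs d hd hd']

theorem connected_skeleton_finitePart (hprime : D.IsPrime) (R : D.Region) :
    (D.finitePart R).skeleton.Connected := by
  obtain ⟨d, rfl⟩ := D.face_surjective R
  let base : (D.finitePart (D.face d)).verts :=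
    ⟨D.regionVertex (D.face (D.flip d)), hprime.face_flip_ne d⟩
  let s (f : D.Region) : Prop :=
    ∃ hf : f ≠ D.face d, (D.finitePart (D.face d)).skeleton.Reachable base ⟨D.regionVertex f, hf⟩
  have h_reach (v : (D.finitePart (D.face d)).verts) :
      (D.finitePart (D.face d)).skeleton.Reachable base v := by
    have h_adj (x : δ) (hx : D.face x ≠ D.face d) (hx' : D.face (D.flip x) ≠ D.face d) :
        (D.finitePart (D.face d)).skeleton.Adj ⟨D.regionVertex (D.face x), hx⟩
          ⟨D.regionVertex (D.face (D.flip x)), hx'⟩ :=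
      ⟨fun h => hprime.face_flip_ne x (congrArg Subtype.val h).symm, D.edge x,
        CellMap.mem_edges_awayFrom.2 ⟨hx, hx'⟩, x, rfl, rfl, rfl⟩
    have h : s (D.face (D.flip d)) = s v.1 := hprime.face_eq_of_ne_region (s := s)
      (fun x hx hx' => propext
        ⟨fun ⟨_, h⟩ => ⟨hx', h.trans (h_adj x hx hx').reachable⟩,
          fun ⟨_, h⟩ => ⟨hx, h.trans (h_adj x hx hx').symm.reachable⟩⟩)
      (hprime.face_flip_ne d) v.2
    exact (h.mp ⟨hprime.face_flip_ne d, .rfl⟩).2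
  have : Nonempty (D.finitePart (D.face d)).verts := ⟨base⟩
  exact ⟨fun u w => (h_reach u).symm.trans (h_reach w)⟩

theorem isDisc_finitePart (hprime : D.IsPrime) (hmin : D.IsMinimal) (R : D.Region) :
    (D.finitePart R).IsDisc := by
  refine ⟨hprime.connected_skeleton_finitePart R, (hprime.boundary_finitePart hmin R).1, ?_⟩
  have h1 := D.ncard_verts_finitePart R
  have h2 := hprime.ncard_edges_finitePart_add R
  have h3 := hprime.ncard_faces_finitePart_add R
  omega

theorem exists_two_adjacent_faces (hprime : D.IsPrime) (hmin : D.IsMinimal) {R : D.Region}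
    {f : D.dualGraph.Face} (hf : f ∈ (D.finitePart R).faces) :
    ∃ g ∈ (D.finitePart R).faces, ∃ h ∈ (D.finitePart R).faces,
      g ≠ f ∧ h ≠ f ∧ g ≠ h ∧ D.dualGraph.FaceAdj f g ∧ D.dualGraph.FaceAdj f h := by
  obtain ⟨v, rfl⟩ := D.dualFace.surjective f
  obtain ⟨x, rfl⟩ := D.vertex_surjective v
  obtain ⟨y, z, hne, hy, hz, hyR, hzR⟩ := hprime.exists_two_not_isCorner_flip hmin
    (CellMap.dualFace_mem_faces_awayFrom.1 hf)
  have face_ne {t : δ} (ht : D.vertex t = D.vertex x) :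
      D.dualFace (D.vertex (D.flip t)) ≠ D.dualFace (D.vertex x) :=
    fun h => hprime.vertex_flip_ne t ((D.dualFace.injective h).trans ht.symm)
  have face_adj {t : δ} (ht : D.vertex t = D.vertex x) :
      D.dualGraph.FaceAdj (D.dualFace (D.vertex x)) (D.dualFace (D.vertex (D.flip t))) :=
    ⟨D.flip t, congrArg D.dualFace ht, rfl⟩
  exact ⟨_, CellMap.dualFace_mem_faces_awayFrom.2 hyR, _,
    CellMap.dualFace_mem_faces_awayFrom.2 hzR, face_ne hy, face_ne hz,
    fun h => hne (hprime.eq_of_parallel hmin (hy.trans hz.symm) (D.dualFace.injective h)),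
    face_adj hy, face_adj hz⟩

theorem dual_edge_eq_of_joins (hprime : D.IsPrime) (hmin : D.IsMinimal) {f g : D.dualGraph.Vertex}
    {e e' : D.dualGraph.Edge} (he : D.dualGraph.Joins e f g) (he' : D.dualGraph.Joins e' f g) :
    e = e' := by
  obtain ⟨d, rfl, rfl, rfl⟩ := he
  obtain ⟨d', rfl, hf, hg⟩ := he'
  rw [hprime.eq_of_face_face_flip hmin hf.symm hg.symm]

end IsPrime

end DoodleDiagram

theorem lemma7p9 {δ : Type*} [Finite δ] (D : DoodleDiagram δ)
    (hmin : D.IsMinimal) (hprime : D.IsPrime)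
    (n : ℕ) (hn : Nat.card D.Crossing = n)
    (R : D.Region) (p : ℕ) (hp : D.toCellMap.sides R = p) :
    let Γ : CellMap δ := D.dualGraph
    let vInf : Γ.Vertex := D.regionVertex R
    let Δ : Γ.Subcomplex := Γ.awayFrom vInf
    (Nat.card Γ.Vertex = n + 2 ∧ Nat.card Γ.Edge = 2 * n ∧ Nat.card Γ.Face = n) ∧
    Δ.IsDisc ∧
    Δ.verts.ncard = n + 1 ∧
    (Δ.boundaryEdges.ncard = 2 * p ∧ Δ.boundaryVerts.ncard = 2 * p) ∧
    ((Δ.interiorEdges.ncard : ℤ) = 2 * n - 3 * p ∧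
      (Δ.interiorVerts.ncard : ℤ) = n + 1 - 2 * p) ∧
    ((Δ.faces.ncard : ℤ) = n - p ∧ ∀ f ∈ Δ.faces, Γ.IsFourSided f) ∧
    (({v ∈ Δ.verts | Γ.valency v = p}.ncard : ℤ) = D.numGons p - 1 ∧
      ∀ i, 3 ≤ i → i ≠ p → {v ∈ Δ.verts | Γ.valency v = i}.ncard = D.numGons i) ∧
    (∀ f ∈ Δ.faces, ∃ g ∈ Δ.faces, ∃ h ∈ Δ.faces,
      g ≠ f ∧ h ≠ f ∧ g ≠ h ∧ Γ.FaceAdj f g ∧ Γ.FaceAdj f h) ∧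
    (∀ u v e e', Γ.Joins e u v → Γ.Joins e' u v → e = e') := by
  intro Γ vInf Δ
  subst hn hp
  obtain ⟨-, hbv, hbe⟩ := hprime.boundary_finitePart hmin R
  exact ⟨⟨D.card_region, D.card_edge, D.card_dual_face⟩,
    hprime.isDisc_finitePart hmin R,
    D.ncard_verts_finitePart R,
    ⟨hbe, hbv⟩,
    ⟨hprime.ncard_interiorEdges_finitePart hmin R, hprime.ncard_interiorVerts_finitePart hmin R⟩,
    ⟨eq_sub_of_add_eq (mod_cast hprime.ncard_faces_finitePart_add R),
      fun f _ => hprime.isFourSided_dual f⟩,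
    ⟨eq_sub_of_add_eq (mod_cast D.ncard_valency_finitePart_self_add_one R),
      fun _ _ hi => D.ncard_valency_finitePart_of_ne hi⟩,
    fun _ hf => hprime.exists_two_adjacent_faces hmin hf,
    fun _ _ _ _ => hprime.dual_edge_eq_of_joins hmin⟩
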